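/- Let $n\ge 1$, let $x_1,\dots,x_n$ be the coordinate functions on $\mathbb{R}^n$, and let $G$ be a simple graph on the vertex set $\{1,\dots,n\}$; write its edges as $ij$ with $i<j$, and put $\mathrm{Cox}(n)=\{x_i-x_j=0 : 1\le i<j\le n\}$. The deleted Shi and Ish arrangements are $$\mathrm{Shi}(G)=\mathrm{Cox}(n)\cup\{x_i-x_j=1 : ij\in G,\ i<j\},\qquad \mathrm{Ish}(G)=\mathrm{Cox}(n)\cup\{x_1-x_j=i : ij\in G,\ i<j\}.$$ For a finite hyperplane arrangement $\mathcal A$ in $\mathbb{R}^n$, let $L(\mathcal A)$ be the poset of nonempty intersections of members of $\mathcal A$ (including the empty intersection $\mathbb{R}^n$), ordered by reverse inclusion, let $\mu$ be its Möbius function, and let $\chi_{\mathcal A}(p)=\sum_{Y\in L(\mathcal A)}\mu(\mathbb{R}^n,Y)\,p^{\dim Y}\in\mathbb{Z}[p]$ be the characteristic polynomial. Let $d_i=\#\{j>i : ij\in G\}$ be the outdegree of the vertex $i$ and $a_j=\#\{i<j : ij\in G\}$ the indegree of the vertex $j$. (a) Suppose that $jk\in G$ and $i<j<k$ imply $ik\in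 G$. Then $$\chi_{\mathrm{Shi}(G)}(p)=\chi_{\mathrm{Ish}(G)}(p)=p\prod_{i=1}^{n-1}(p-d_i-i).$$ (b) Suppose that $ij\in G$ and $i<j<k$ imply $ik\in G$. Then $$\chi_{\mathrm{Shi}(G)}(p)=\chi_{\mathrm{Ish}(G)}(p)=p\prod_{j=2}^{n}\bigl(p-a_j-(n+1-j)\bigr).$$ -/

import Mathlib

open Polynomial

noncomputable section

namespace ShiIsh

/-- The affine subspace `x_i - x_j = c` of `ℝⁿ` (a hyperplane when `i ≠ j`). -/
def diffHyperplane {n : ℕ} (i j : Fin n) (c : ℝ) : AffineSubspace ℝ (Fin n → ℝ) where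
  carrier := {x | x i - x j = c}
  smul_vsub_vadd_mem' := by
    intro t x y z hx hy hz
    simp only [Set.mem_ofPred_eq, vsub_eq_sub, vadd_eq_add, Pi.add_apply, Pi.smul_apply,
      Pi.sub_apply, smul_eq_mul] at *
    linear_combination t * (hx - hy) + hz

/-- The intersection poset of a finite arrangement `A` in `ℝⁿ`: all nonempty intersections of
members of `A` (the empty intersection being `ℝⁿ`), ordered by reverse inclusion. -/
abbrev IntersectionPoset {n : ℕ} (A : Finset (AffineSubspace ℝ (Fin n → ℝ))) : Type :=
  {X : (AffineSubspace ℝ (Fin n → ℝ))ᵒᵈ //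
    OrderDual.ofDual X ≠ ⊥ ∧
      ∃ S : Set (AffineSubspace ℝ (Fin n → ℝ)), S ⊆ A ∧ OrderDual.ofDual X = sInf S}

instance {n : ℕ} (A : Finset (AffineSubspace ℝ (Fin n → ℝ))) : Finite (IntersectionPoset A) := by
  have h : {X : (AffineSubspace ℝ (Fin n → ℝ))ᵒᵈ |
      OrderDual.ofDual X ≠ ⊥ ∧
        ∃ S : Set (AffineSubspace ℝ (Fin n → ℝ)), S ⊆ A ∧ OrderDual.ofDual X = sInf S}.Finite := by
    refine ((A.finite_toSet.powerset).image (fun S => OrderDual.toDual (sInf S))).subset ?_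
    rintro X ⟨-, S, hS, hX⟩
    exact ⟨S, hS, congrArg OrderDual.toDual hX.symm⟩
  exact h.to_subtype

instance {n : ℕ} (A : Finset (AffineSubspace ℝ (Fin n → ℝ))) : Fintype (IntersectionPoset A) :=
  Fintype.ofFinite _

open Classical in
instance {n : ℕ} (A : Finset (AffineSubspace ℝ (Fin n → ℝ))) :
    LocallyFiniteOrder (IntersectionPoset A) :=
  Fintype.toLocallyFiniteOrder

/-- The minimum of the intersection poset: the whole space `ℝⁿ`. -/
def wholeSpace {n : ℕ} (A : Finset (AffineSubspace ℝ (Fin n → ℝ))) : IntersectionPoset A :=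
  ⟨OrderDual.toDual ⊤, by simp, ∅, by simp, by simp⟩

open Classical in
/-- The characteristic polynomial `∑ μ(ℝⁿ, Y) p ^ dim Y`, the sum being over the intersection
poset and `μ` its Möbius function. -/
def charPoly {n : ℕ} (A : Finset (AffineSubspace ℝ (Fin n → ℝ))) : ℤ[X] :=
  ∑ Y : IntersectionPoset A,
    C (IncidenceAlgebra.mu ℤ (wholeSpace A) Y) *
      X ^ Module.finrank ℝ (OrderDual.ofDual Y.1).direction

open Classical in
/-- The edges `ij` of `G`, written with `i < j`. -/
def edges {n : ℕ} (G : SimpleGraph (Fin n)) : Finset (Fin n × Fin n) :=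
  Finset.univ.filter fun e => e.1 < e.2 ∧ G.Adj e.1 e.2

open Classical in
/-- The Coxeter (braid) arrangement: all `x_i - x_j = 0` with `i < j`. -/
def cox (n : ℕ) : Finset (AffineSubspace ℝ (Fin n → ℝ)) :=
  (Finset.univ.filter fun e : Fin n × Fin n => e.1 < e.2).image
    fun e => diffHyperplane e.1 e.2 0

open Classical in
/-- The deleted Shi arrangement: `cox n` and all `x_i - x_j = 1` with `ij` an edge, `i < j`. -/
def shi {n : ℕ} (G : SimpleGraph (Fin n)) : Finset (AffineSubspace ℝ (Fin n → ℝ)) :=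
  cox n ∪ (edges G).image fun e => diffHyperplane e.1 e.2 1

open Classical in
/-- The deleted Ish arrangement: `cox n` and all `x_1 - x_j = i` with `ij` an edge, `i < j`.
The vertex labelled `i` in `{1, …, n}` is the element `i - 1` of `Fin n`. -/
def ish {n : ℕ} [NeZero n] (G : SimpleGraph (Fin n)) : Finset (AffineSubspace ℝ (Fin n → ℝ)) :=
  cox n ∪ (edges G).image fun e => diffHyperplane 0 e.2 (((e.1 : ℕ) : ℝ) + 1)

open Classical in
/-- The outdegree of `i`: the number of edges `ij` with `i < j`. -/
def outdegree {n : ℕ} (G : SimpleGraph (Fin n)) (i : Fin n) : ℕ :=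
  (Finset.univ.filter fun j => i < j ∧ G.Adj i j).card

open Classical in
/-- The indegree of `j`: the number of edges `ij` with `i < j`. -/
def indegree {n : ℕ} (G : SimpleGraph (Fin n)) (j : Fin n) : ℕ :=
  (Finset.univ.filter fun i => i < j ∧ G.Adj i j).card

end ShiIsh

end

/-! The proof is the finite field method. By Whitney's theorem (`charPoly_image`) and
inclusion–exclusion (`ncard_avoiding`), a polynomial that counts the points of `(ℤ/q)ⁿ` off a
difference arrangement for all large `q` is its characteristic polynomial
(`charPoly_eq_of_ncard_avoiding`). For both arrangements such a point has distinct coordinates, and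
translation along the diagonal contributes a factor `q`.

For Shi, put the last vertex at `0`. The circle `ℤ/q` is then cut open into a line, and no vertex
may directly follow a larger neighbour. In case (a) the smallest vertex can be deleted and the line
closed up; it can be put back after any place not held by one of its neighbours, which yields one
factor of the product (`ncard_linearShi`). Case (b) follows by negating the coordinates and
reversing the labels (`ncard_shiPoints_comap_rev`).

For Ish, put the first vertex at `0`. The remaining coordinates, negated, form a placement of rooks
on the nonzero residues, and the edges are the forbidden cells. In case (b) the allowed sets of the
columns are nested, so the placements are counted greedily. In case (a) those of the rows are
nested, and transposing the board does not change the count (`ncard_injectionsInto_allowed_swap`).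
-/

namespace ShiIsh

/-! ### Whitney's theorem -/

section Whitney

/-- The sums over intervals determine the Möbius function recursively; the induction is on the size
of the interval. -/
theorem mu_eq_of_sum_Icc {P : Type*} [PartialOrder P] [LocallyFiniteOrder P] [DecidableEq P] (a : P)
    (w : P → ℤ) (h : ∀ y, a ≤ y → ∑ z ∈ Finset.Icc a y, w z = if a = y then 1 else 0)
    (y : P) (hy : a ≤ y) : IncidenceAlgebra.mu ℤ a y = w y := by
  suffices H : ∀ m : ℕ, ∀ y, a ≤ y → (Finset.Icc a y).card ≤ m →
      IncidenceAlgebra.mu ℤ a y = w y from H _ y hy le_rfl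
  intro m
  induction m with
  | zero =>
    intro y hy hm
    have : a ∈ Finset.Icc a y := Finset.mem_Icc.2 ⟨le_rfl, hy⟩
    simp only [nonpos_iff_eq_zero, Finset.card_eq_zero] at hm
    simp [hm] at this
  | succ m ih =>
    intro y hy hm
    have h1 := h y hy
    rw [← Finset.Ico_insert_right hy, Finset.sum_insert (by simp)] at h1
    have h2 : ∑ z ∈ Finset.Ico a y, IncidenceAlgebra.mu ℤ a z = ∑ z ∈ Finset.Ico a y, w z := by
      refine Finset.sum_congr rfl fun z hz => ?_
      rw [Finset.mem_Ico] at hz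
      refine ih z hz.1 ?_
      have : Finset.Icc a z ⊂ Finset.Icc a y :=
        Finset.Icc_ssubset_Icc_right hy le_rfl hz.2
      have := Finset.card_lt_card this
      omega
    rw [IncidenceAlgebra.mu_apply]
    split_ifs with hay
    · subst hay
      simpa using h1.symm
    · rw [h2]
      rw [if_neg hay] at h1
      linarith

variable {n : ℕ} {ι : Type*}

open Classical in
-- The sum runs over all subsets of the set of hyperplanes containing `Y`, so it vanishes unless
-- that set is empty, which means that `Y` is the whole space.
theorem sum_powerset_le_sInf (T : Finset ι) (H : ι → AffineSubspace ℝ (Fin n → ℝ))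
    (hH : ∀ t ∈ T, H t ≠ ⊤) (Y : IntersectionPoset (T.image H)) :
    ∑ S ∈ T.powerset.filter (fun S : Finset ι => OrderDual.ofDual Y.1 ≤ sInf (H '' S)), (-1 : ℤ) ^ S.card =
      if wholeSpace (T.image H) = Y then 1 else 0 := by
  have h1 : (T.powerset.filter fun S : Finset ι => OrderDual.ofDual Y.1 ≤ sInf (H '' S)) =
      (T.filter fun t => OrderDual.ofDual Y.1 ≤ H t).powerset := by
    ext S
    simp only [Finset.mem_filter, Finset.mem_powerset, le_sInf_iff, Set.mem_image,
      Finset.mem_coe, forall_exists_index, and_imp, forall_apply_eq_imp_iff₂]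
    constructor
    · rintro ⟨h1, h2⟩ t ht
      exact Finset.mem_filter.2 ⟨h1 ht, h2 t ht⟩
    · intro h
      exact ⟨fun t ht => (Finset.mem_filter.1 (h ht)).1, fun t ht => (Finset.mem_filter.1 (h ht)).2⟩
  rw [h1, Finset.sum_powerset_neg_one_pow_card]
  congr 1
  rw [eq_iff_iff, Finset.filter_eq_empty_iff]
  obtain ⟨Y, hY, S, hS, hYS⟩ := Y
  constructor
  · intro h
    have : S = ∅ := by
      rw [Set.eq_empty_iff_forall_notMem]
      intro s hs
      have := hS hs
      simp only [Finset.coe_image, Set.mem_image, Finset.mem_coe] at this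
      obtain ⟨t, ht, rfl⟩ := this
      exact h ht (hYS.trans_le (sInf_le hs))
    subst this
    apply Subtype.ext
    simp only [sInf_empty] at hYS
    exact congrArg OrderDual.toDual hYS.symm
  · intro h t ht hle
    have h2 : Y = OrderDual.toDual ⊤ := (congrArg Subtype.val h).symm
    subst h2
    exact hH t ht (top_le_iff.1 hle)

open Classical in
theorem mu_wholeSpace (T : Finset ι) (H : ι → AffineSubspace ℝ (Fin n → ℝ))
    (hH : ∀ t ∈ T, H t ≠ ⊤) (Y : IntersectionPoset (T.image H)) :
    IncidenceAlgebra.mu ℤ (wholeSpace (T.image H)) Y =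
      ∑ S ∈ T.powerset, if sInf (H '' S) = OrderDual.ofDual Y.1 then (-1 : ℤ) ^ S.card else 0 := by
  have hmin : ∀ Y : IntersectionPoset (T.image H), wholeSpace (T.image H) ≤ Y := fun Y =>
    (le_top : OrderDual.ofDual Y.1 ≤ ⊤)
  refine mu_eq_of_sum_Icc _ (fun Y : IntersectionPoset (T.image H) => ∑ S ∈ T.powerset,
    if sInf (H '' S) = OrderDual.ofDual Y.1 then (-1 : ℤ) ^ S.card else 0) ?_ Y (hmin Y)
  intro Y _
  rw [Finset.sum_comm, ← sum_powerset_le_sInf T H hH Y, Finset.sum_filter]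
  refine Finset.sum_congr rfl fun S hS => ?_
  rw [Finset.mem_powerset] at hS
  split_ifs with hle
  -- The intersection of `S` contains `Y`, hence is nonempty, so it is an element of the poset, and
  -- it is the only one to which `S` contributes.
  · let Z : IntersectionPoset (T.image H) := ⟨OrderDual.toDual (sInf (H '' S)),
      fun hbot => Y.2.1 (le_bot_iff.1 (hle.trans_eq hbot)), H '' S, by
        simpa using Set.image_mono hS, rfl⟩
    rw [Finset.sum_eq_single Z]
    · exact if_pos rfl
    · intro Z' _ hne
      refine if_neg fun h => hne (Subtype.ext ?_)
      exact congrArg OrderDual.toDual h.symm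
    · intro hZ
      exact absurd (Finset.mem_Icc.2 ⟨hmin Z, hle⟩) hZ
  · refine Finset.sum_eq_zero fun Z hZ => if_neg fun h => hle ?_
    rw [h]
    exact (Finset.mem_Icc.1 hZ).2

open Classical in
/-- Whitney's theorem for an indexed arrangement. -/
theorem charPoly_image (T : Finset ι) (H : ι → AffineSubspace ℝ (Fin n → ℝ))
    (hH : ∀ t ∈ T, H t ≠ ⊤) :
    charPoly (T.image H) = ∑ S ∈ T.powerset, (-1 : ℤ[X]) ^ S.card *
      if sInf (H '' S) = ⊥ then 0
      else X ^ Module.finrank ℝ (sInf (H '' S) : AffineSubspace ℝ (Fin n → ℝ)).direction := by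
  unfold charPoly
  have : ∀ Y : IntersectionPoset (T.image H), C (IncidenceAlgebra.mu ℤ (wholeSpace _) Y) *
      (X : ℤ[X]) ^ Module.finrank ℝ (OrderDual.ofDual Y.1).direction =
      ∑ S ∈ T.powerset, if sInf (H '' S) = OrderDual.ofDual Y.1 then
        (-1 : ℤ[X]) ^ S.card * X ^ Module.finrank ℝ (sInf (H '' S) :
          AffineSubspace ℝ (Fin n → ℝ)).direction else 0 := by
    intro Y
    rw [mu_wholeSpace T H hH, map_sum, Finset.sum_mul]
    refine Finset.sum_congr rfl fun S _ => ?_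
    split_ifs with h
    · rw [h]; simp
    · simp
  rw [Finset.sum_congr rfl fun Y _ => this Y, Finset.sum_comm]
  refine Finset.sum_congr rfl fun S hS => ?_
  rw [Finset.mem_powerset] at hS
  split_ifs with hbot
  · rw [mul_zero]
    exact Finset.sum_eq_zero fun Y _ => if_neg fun h => Y.2.1 (h.symm.trans hbot)
  · let Z : IntersectionPoset (T.image H) := ⟨OrderDual.toDual (sInf (H '' S)), hbot, H '' S, by
        simpa using Set.image_mono hS, rfl⟩
    rw [Finset.sum_eq_single Z]
    · exact if_pos rfl
    · intro Z' _ hne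
      refine if_neg fun h => hne (Subtype.ext ?_)
      exact congrArg OrderDual.toDual h.symm
    · simp

end Whitney

/-! ### The finite field method for difference arrangements -/

section Difference

variable {n : ℕ}

/-- The solutions in `Rⁿ` of the equations `x_i - x_j = c`, `(i, j, c)` ranging over `S`. -/
def solutions (R : Type*) [Ring R] (S : Finset (Fin n × Fin n × ℤ)) : Set (Fin n → R) :=
  {x | ∀ t ∈ S, x t.1 - x t.2.1 = (t.2.2 : R)}

/-- The partition of the coordinates into the connected components of the graph with edges `ij`,
`(i, j, c) ∈ S`. -/
def components (S : Finset (Fin n × Fin n × ℤ)) : Setoid (Fin n) :=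
  Relation.EqvGen.setoid fun i j => ∃ c, (i, j, c) ∈ S

theorem eq_of_components {α : Type*} {S : Finset (Fin n × Fin n × ℤ)} {f : Fin n → α}
    (hf : ∀ t ∈ S, f t.1 = f t.2.1) {i j : Fin n} (h : components S i j) : f i = f j := by
  have : components S ≤ Setoid.ker f := Setoid.eqvGen_le (by
    rintro i j ⟨c, hc⟩
    exact hf _ hc)
  exact this h

/-- The difference of two solutions is constant on components. This holds over every ring, so the
number of components gives both the real dimension and the count modulo `q`. -/
theorem solutions_eq_range {R : Type*} [Ring R] {S : Finset (Fin n × Fin n × ℤ)}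
    {x₀ : Fin n → R} (h₀ : x₀ ∈ solutions R S) :
    solutions R S = Set.range fun f : Quotient (components S) → R =>
      fun i => x₀ i + f (Quotient.mk _ i) := by
  ext x
  constructor
  · intro hx
    have hc : ∀ i j, components S i j → (x - x₀) i = (x - x₀) j := fun i j hij => by
      refine eq_of_components (fun t ht => ?_) hij
      have h1 := hx t ht
      have h2 := h₀ t ht
      simp only [Pi.sub_apply]
      rw [sub_eq_sub_iff_sub_eq_sub, h1, h2]
    refine ⟨Quotient.lift (x - x₀) hc, ?_⟩
    ext i
    simp
  · rintro ⟨f, rfl⟩ t ht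
    have : (Quotient.mk (components S) t.1) = Quotient.mk (components S) t.2.1 :=
      Quotient.sound (Relation.EqvGen.rel _ _ ⟨t.2.2, ht⟩)
    simp only [this, add_sub_add_right_eq_sub]
    exact h₀ t ht

theorem add_comp_mk_injective {R : Type*} [Ring R] (S : Finset (Fin n × Fin n × ℤ))
    (x₀ : Fin n → R) : Function.Injective fun f : Quotient (components S) → R =>
      fun i => x₀ i + f (Quotient.mk _ i) := by
  intro f g h
  ext c
  induction c using Quotient.inductionOn with
  | h i => simpa using congrFun h i

theorem card_solutions {q : ℕ} [NeZero q] {S : Finset (Fin n × Fin n × ℤ)}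
    (h : (solutions (ZMod q) S).Nonempty) :
    (solutions (ZMod q) S).ncard = q ^ Nat.card (Quotient (components S)) := by
  obtain ⟨x₀, h₀⟩ := h
  rw [solutions_eq_range h₀, Set.ncard_range_of_injective (add_comp_mk_injective S x₀)]
  simp [Nat.card_fun]

theorem mem_sInf_diffHyperplane (S : Finset (Fin n × Fin n × ℤ)) (x : Fin n → ℝ) :
    x ∈ sInf ((fun t : Fin n × Fin n × ℤ => diffHyperplane t.1 t.2.1 (t.2.2 : ℝ)) '' S) ↔
      x ∈ solutions ℝ S := by
  rw [AffineSubspace.mem_sInf_iff]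
  simp only [Set.mem_image, forall_exists_index, and_imp, forall_apply_eq_imp_iff₂]
  rfl

theorem finrank_direction_sInf {S : Finset (Fin n × Fin n × ℤ)}
    (h : (solutions ℝ S).Nonempty) :
    Module.finrank ℝ (sInf ((fun t : Fin n × Fin n × ℤ =>
      diffHyperplane t.1 t.2.1 (t.2.2 : ℝ)) '' S)).direction =
        Nat.card (Quotient (components S)) := by
  classical
  obtain ⟨x₀, h₀⟩ := h
  have hP : sInf ((fun t : Fin n × Fin n × ℤ => diffHyperplane t.1 t.2.1 (t.2.2 : ℝ)) '' S) =
      AffineSubspace.mk' x₀ (LinearMap.range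
        (LinearMap.funLeft ℝ ℝ (Quotient.mk (components S)))) := by
    ext x
    rw [mem_sInf_diffHyperplane, solutions_eq_range h₀, AffineSubspace.mem_mk']
    simp only [Set.mem_range, LinearMap.mem_range, vsub_eq_sub]
    refine exists_congr fun f => ?_
    rw [eq_sub_iff_add_eq']
    rfl
  rw [hP, AffineSubspace.direction_mk', LinearMap.finrank_range_of_inj
    (LinearMap.funLeft_injective_of_surjective _ _ _ Quotient.mk_surjective)]
  simp

theorem solutions_int_of_real {S : Finset (Fin n × Fin n × ℤ)}
    (h : (solutions ℝ S).Nonempty) : (solutions ℤ S).Nonempty := by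
  obtain ⟨x, hx⟩ := h
  -- Differences along `S` are integers, so taking floors preserves them.
  refine ⟨fun i => ⌊x i⌋, fun t ht => ?_⟩
  have h1 : x t.1 = x t.2.1 + (t.2.2 : ℝ) := by rw [← hx t ht]; ring
  simp [h1]

theorem solutions_map_int {R : Type*} [Ring R] {S : Finset (Fin n × Fin n × ℤ)} {z : Fin n → ℤ}
    (h : z ∈ solutions ℤ S) : (fun i => (z i : R)) ∈ solutions R S := by
  intro t ht
  have := h t ht
  simp only [Int.cast_id] at this
  rw [← this]
  push_cast
  rfl

theorem solutions_mono {R : Type*} [Ring R] {S T : Finset (Fin n × Fin n × ℤ)} (h : S ⊆ T) :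
    solutions R T ⊆ solutions R S := fun _ hx t ht => hx t (h ht)

/-- An equation joining two components can always be met by a shift. One inside a component has a
fixed integer defect, and a nonzero defect does not vanish modulo a larger `q`. -/
theorem exists_bound_solutions_int (S : Finset (Fin n × Fin n × ℤ)) :
    ∃ Q : ℕ, ∀ q : ℕ, Q ≤ q → (solutions (ZMod q) S).Nonempty → (solutions ℤ S).Nonempty := by
  classical
  induction S using Finset.induction_on with
  | empty => exact ⟨0, fun q _ _ => ⟨0, fun t ht => by simp at ht⟩⟩
  | insert t S ht ih =>
    obtain ⟨Q, hQ⟩ := ih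
    by_cases hS : (solutions ℤ S).Nonempty
    swap
    · exact ⟨Q, fun q hq hne => absurd
        (hQ q hq (hne.mono (solutions_mono (Finset.subset_insert _ _)))) hS⟩
    obtain ⟨z, hz⟩ := hS
    obtain ⟨i, j, c⟩ := t
    by_cases hij : components S i j
    -- The defect of `z` in the new equation is `z i - z j - c`; any larger `q` that divides it
    -- forces it to be zero.
    · refine ⟨(z i - z j - c).natAbs + 1, fun q hq ⟨x, hx⟩ => ⟨z, ?_⟩⟩
      have h1 : x i - (z i : ZMod q) = x j - (z j : ZMod q) := by
        refine eq_of_components (f := fun i => x i - (z i : ZMod q)) (fun t ht => ?_) hij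
        have e1 := hx t (Finset.mem_insert_of_mem ht)
        have e2 := solutions_map_int (R := ZMod q) hz t ht
        simp only at e2 ⊢
        rw [sub_eq_sub_iff_sub_eq_sub, e1, e2]
      have h2 : x i - x j = (c : ZMod q) := hx _ (Finset.mem_insert_self _ _)
      have h3 : ((z i - z j - c : ℤ) : ZMod q) = 0 := by
        push_cast
        rw [← h2]
        linear_combination -h1
      rw [ZMod.intCast_zmod_eq_zero_iff_dvd] at h3
      have h4 : z i - z j - c = 0 := by
        refine Int.eq_zero_of_abs_lt_dvd h3 ?_
        rw [Int.abs_eq_natAbs]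
        omega
      intro t ht
      rcases Finset.mem_insert.1 ht with rfl | ht
      · simp only [Int.cast_id]
        omega
      · exact hz t ht
    -- Shifting the whole component of `i` repairs the new equation and disturbs none of the others.
    · refine ⟨0, fun q _ _ => ⟨fun k => z k + if components S k i then c - (z i - z j) else 0, ?_⟩⟩
      intro t ht
      rcases Finset.mem_insert.1 ht with rfl | ht
      · have hji : ¬ components S j i := fun h => hij ((components S).symm h)
        simp only [(components S).refl i, hji, if_true, if_false, Int.cast_id]
        ring
      · have hc : components S t.1 t.2.1 := Relation.EqvGen.rel _ _ ⟨t.2.2, ht⟩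
        have : components S t.1 i ↔ components S t.2.1 i :=
          ⟨fun h => (components S).trans ((components S).symm hc) h, (components S).trans hc⟩
        have e := hz t ht
        simp only [this, Int.cast_id] at e ⊢
        rw [← e]
        ring

open Classical in
-- For large `q`, the term of `S` in Whitney's formula is the number of solutions of `S` modulo `q`.
theorem exists_bound_eval (S : Finset (Fin n × Fin n × ℤ)) :
    ∃ Q : ℕ, ∀ q : ℕ, Q ≤ q → ∀ [NeZero q], ((solutions (ZMod q) S).ncard : ℤ) =
      Polynomial.eval (q : ℤ) (if sInf ((fun t : Fin n × Fin n × ℤ =>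
          diffHyperplane t.1 t.2.1 (t.2.2 : ℝ)) '' S) = ⊥ then 0
        else X ^ Module.finrank ℝ (sInf ((fun t : Fin n × Fin n × ℤ =>
          diffHyperplane t.1 t.2.1 (t.2.2 : ℝ)) '' S)).direction) := by
  obtain ⟨Q, hQ⟩ := exists_bound_solutions_int S
  have hbot : sInf ((fun t : Fin n × Fin n × ℤ => diffHyperplane t.1 t.2.1 (t.2.2 : ℝ)) '' S) = ⊥ ↔
      ¬ (solutions ℝ S).Nonempty := by
    rw [← AffineSubspace.coe_eq_bot_iff, Set.not_nonempty_iff_eq_empty]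
    have : ((sInf ((fun t : Fin n × Fin n × ℤ => diffHyperplane t.1 t.2.1 (t.2.2 : ℝ)) '' S) :
      AffineSubspace ℝ (Fin n → ℝ)) : Set (Fin n → ℝ)) = solutions ℝ S := by
      ext x
      exact mem_sInf_diffHyperplane S x
    rw [this]
  refine ⟨Q, fun q hq _ => ?_⟩
  split_ifs with h
  · rw [hbot] at h
    have : solutions (ZMod q) S = ∅ := by
      rw [← Set.not_nonempty_iff_eq_empty]
      intro hne
      obtain ⟨z, hz⟩ := hQ q hq hne
      exact h ⟨_, solutions_map_int hz⟩
    simp [this]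
  · rw [hbot, not_not] at h
    obtain ⟨z, hz⟩ := solutions_int_of_real h
    rw [card_solutions ⟨_, solutions_map_int hz⟩, finrank_direction_sInf h]
    simp

/-- The points of `(ℤ/q)ⁿ` that avoid the hyperplanes `x_i - x_j = c`, `(i, j, c) ∈ T`. -/
def avoiding (q : ℕ) (T : Finset (Fin n × Fin n × ℤ)) : Set (Fin n → ZMod q) :=
  {x | ∀ t ∈ T, x t.1 - x t.2.1 ≠ (t.2.2 : ZMod q)}

theorem ncard_avoiding (q : ℕ) [NeZero q] (T : Finset (Fin n × Fin n × ℤ)) :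
    ((avoiding q T).ncard : ℤ) =
      ∑ S ∈ T.powerset, (-1 : ℤ) ^ S.card * (solutions (ZMod q) S).ncard := by
  classical
  have h := Finset.inclusion_exclusion_card_inf_compl T
    (fun t : Fin n × Fin n × ℤ => Finset.univ.filter
      fun x : Fin n → ZMod q => x t.1 - x t.2.1 = (t.2.2 : ZMod q))
  convert h using 2
  · rw [← Set.ncard_coe_finset]
    congr 1
    ext x
    simp [avoiding, Finset.mem_inf]
  · congr 1
    rw [← Set.ncard_coe_finset]
    congr 2
    ext x
    simp [solutions, Finset.mem_inf]

theorem diffHyperplane_ne_top {i j : Fin n} (hij : i ≠ j) (c : ℝ) : diffHyperplane i j c ≠ ⊤ := by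
  intro h
  have h1 : (Pi.single i (c + 1) : Fin n → ℝ) ∈ diffHyperplane i j c := by
    rw [h]; trivial
  have h2 : (Pi.single i (c + 1) : Fin n → ℝ) i - (Pi.single i (c + 1) : Fin n → ℝ) j = c := h1
  rw [Pi.single_eq_same, Pi.single_eq_of_ne hij.symm] at h2
  linarith

open Classical in
/-- The characteristic polynomial of a difference arrangement counts, for all large `q`, the
points of `(ℤ/q)ⁿ` that avoid the arrangement. -/
theorem exists_bound_charPoly (T : Finset (Fin n × Fin n × ℤ)) (hT : ∀ t ∈ T, t.1 ≠ t.2.1) :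
    ∃ Q : ℕ, ∀ q : ℕ, Q ≤ q → 0 < q → (charPoly (T.image fun t : Fin n × Fin n × ℤ =>
      diffHyperplane t.1 t.2.1 (t.2.2 : ℝ))).eval (q : ℤ) = (avoiding q T).ncard := by
  choose Q hQ using fun S : Finset (Fin n × Fin n × ℤ) => exists_bound_eval S
  refine ⟨T.powerset.sup Q, fun q hq hpos => ?_⟩
  have : NeZero q := ⟨hpos.ne'⟩
  rw [ncard_avoiding, charPoly_image T _ fun t ht => diffHyperplane_ne_top (hT t ht) _,
    Polynomial.eval_finsetSum]
  refine Finset.sum_congr rfl fun S hS => ?_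
  rw [hQ S q ((Finset.le_sup hS).trans hq), Polynomial.eval_mul]
  simp

/-- A polynomial that counts the points avoiding a difference arrangement in `(ℤ/q)ⁿ` for all
large `q` is its characteristic polynomial. -/
theorem charPoly_eq_of_ncard_avoiding (T : Finset (Fin n × Fin n × ℤ))
    (hT : ∀ t ∈ T, t.1 ≠ t.2.1) (P : ℤ[X]) (N : ℕ)
    (hP : ∀ q : ℕ, N ≤ q → 0 < q → ((avoiding q T).ncard : ℤ) = P.eval (q : ℤ))
    (A : Finset (AffineSubspace ℝ (Fin n → ℝ)))
    (hA : ∀ Y, Y ∈ A ↔ ∃ t ∈ T, diffHyperplane t.1 t.2.1 (t.2.2 : ℝ) = Y) :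
    charPoly A = P := by
  classical
  have hA' : A = T.image fun t : Fin n × Fin n × ℤ => diffHyperplane t.1 t.2.1 (t.2.2 : ℝ) := by
    ext Y
    simp only [hA, Finset.mem_image]
  subst hA'
  obtain ⟨Q, hQ⟩ := exists_bound_charPoly T hT
  refine Polynomial.eq_of_infinite_eval_eq _ _ ?_
  refine Set.Infinite.mono (s := ((fun q : ℕ => (q : ℤ)) '' Set.Ici (Q + N + 1))) ?_ ?_
  · rintro _ ⟨q, hq, rfl⟩
    have hq : Q + N + 1 ≤ q := hq
    show _ = _
    rw [hQ q (by omega) (by omega), hP q (by omega) (by omega)]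
  · exact (Set.infinite_coe_iff.1 inferInstance : (Set.Ici (Q + N + 1)).Infinite).image
      (Nat.cast_injective.injOn)

end Difference

end ShiIsh

namespace ShiIsh

/-! ### Translation along the diagonal -/

section Translation

theorem ncard_eq_mul_of_translation {n q : ℕ} [NeZero q] (A : Set (Fin n → ZMod q)) (k : Fin n)
    (hA : ∀ x ∈ A, ∀ c : ZMod q, (fun i => x i + c) ∈ A) :
    A.ncard = q * {x ∈ A | x k = 0}.ncard := by
  have h : A = (fun p : ZMod q × (Fin n → ZMod q) => fun i => p.2 i + p.1) ''
      (Set.univ ×ˢ {x ∈ A | x k = 0}) := by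
    ext x
    constructor
    · intro hx
      refine ⟨(x k, fun i => x i + -x k), ⟨trivial, hA x hx _, by simp⟩, ?_⟩
      ext i
      simp
    · rintro ⟨⟨c, y⟩, ⟨-, hy, -⟩, rfl⟩
      exact hA y hy c
  conv_lhs => rw [h]
  rw [Set.InjOn.ncard_image, Set.ncard_prod, Set.ncard_univ, Nat.card_zmod]
  rintro ⟨c, y⟩ ⟨-, -, hy⟩ ⟨d, z⟩ ⟨-, -, hz⟩ hyz
  have hcd : c = d := by simpa [show y k = 0 from hy, show z k = 0 from hz] using congrFun hyz k
  subst hcd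
  have : y = z := by
    ext i
    simpa using congrFun hyz i
  rw [this]

end Translation

/-! ### Points off the deleted Shi arrangement -/

section Shi

/-- The placements of the vertices on a line of `q + 1` places, the last vertex on the first place,
such that no vertex `i` directly follows a neighbour `j > i`. -/
def linearShi {n : ℕ} (q : ℕ) (G : SimpleGraph (Fin (n + 1))) : Set (Fin (n + 1) → Fin (q + 1)) :=
  {x | Function.Injective x ∧ x (Fin.last n) = 0 ∧
    ∀ i j, i < j → G.Adj i j → (x i : ℕ) ≠ x j + 1}

theorem val_succAbove_succ {q : ℕ} (s a : Fin (q + 1)) :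
    ((s.succ.succAbove a : Fin (q + 2)) : ℕ) = if (a : ℕ) ≤ s then (a : ℕ) else a + 1 := by
  simp only [Fin.succAbove, Fin.lt_def, Fin.val_castSucc, Fin.val_succ]
  split_ifs <;> simp <;> omega

/-- Put the vertex `0` on the place after `s`, and the vertex `j + 1` where `y` puts `j`. -/
def insertZero {n q : ℕ} (p : (Fin (n + 1) → Fin (q + 1)) × Fin (q + 1)) :
    Fin (n + 2) → Fin (q + 2) :=
  Fin.cons p.2.succ (fun j => p.2.succ.succAbove (p.1 j))

theorem insertZero_injective {n q : ℕ} : Function.Injective (insertZero (n := n) (q := q)) := by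
  rintro ⟨y, s⟩ ⟨z, t⟩ h
  have h0 : s = t := by simpa [insertZero] using congrFun h 0
  subst h0
  have : y = z := by
    ext1 j
    simpa [insertZero] using congrFun h j.succ
  rw [this]

/-- Deleting the vertex `0` could only create a forbidden pair if `0` stood right behind `j` and
right before a smaller neighbour of `j`. By `hG`, `j` would then be a neighbour of `0`, and `0`
could not follow it. -/
theorem insertZero_mem_linearShi {n q : ℕ} {G : SimpleGraph (Fin (n + 2))}
    (hG : ∀ i j k : Fin (n + 2), i < j → j < k → G.Adj j k → G.Adj i k)
    (y : Fin (n + 1) → Fin (q + 1)) (s : Fin (q + 1)) :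
    insertZero (y, s) ∈ linearShi (q + 1) G ↔
      y ∈ linearShi q (G.comap Fin.succ) ∧ ∀ j, G.Adj 0 j.succ → y j ≠ s := by
  have e0 : insertZero (y, s) 0 = s.succ := rfl
  have es : ∀ j, insertZero (y, s) (Fin.succ j) = s.succ.succAbove (y j) := fun j => rfl
  have vs : ∀ j, ((insertZero (y, s) (Fin.succ j) : Fin (q + 2)) : ℕ) =
      if (y j : ℕ) ≤ s then (y j : ℕ) else y j + 1 := fun j => by rw [es, val_succAbove_succ]
  have hinj : Function.Injective (insertZero (y, s)) ↔ Function.Injective y := by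
    rw [insertZero, Fin.cons_injective_iff]
    constructor
    · rintro ⟨-, h⟩ i j hij
      exact h (congrArg _ hij)
    · intro h
      exact ⟨by rintro ⟨j, hj⟩; exact Fin.succAbove_ne _ _ hj,
        Fin.succAbove_right_injective.comp h⟩
  have hlast : insertZero (y, s) (Fin.last (n + 1)) = 0 ↔ y (Fin.last n) = 0 := by
    rw [← Fin.succ_last, Fin.ext_iff, Fin.ext_iff, vs]
    change _ ↔ _ = (0 : ℕ)
    split_ifs with h
    · rfl
    · exact ⟨fun h' => absurd h' (Nat.succ_ne_zero _), fun h' => by omega⟩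
  constructor
  · rintro ⟨h1, h2, h3⟩
    have hs : ∀ j, G.Adj 0 j.succ → y j ≠ s := by
      intro j hj hys
      refine h3 0 j.succ (Fin.succ_pos j) hj ?_
      rw [vs, e0, hys]
      simp
    refine ⟨⟨hinj.1 h1, hlast.1 h2, fun i j hij hadj h => ?_⟩, hs⟩
    have hadj : G.Adj i.succ j.succ := hadj
    have hij' : i.succ < j.succ := Fin.succ_lt_succ_iff.2 hij
    have h4 := h3 _ _ hij' hadj
    have h5 := hs j (hG 0 i.succ j.succ (Fin.succ_pos i) hij' hadj)
    rw [vs, vs] at h4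
    have h6 : (y j : ℕ) ≠ s := fun h => h5 (Fin.ext h)
    split_ifs at h4 <;> omega
  · rintro ⟨⟨h1, h2, h3⟩, hs⟩
    refine ⟨hinj.2 h1, hlast.2 h2, fun i j hij hadj h => ?_⟩
    obtain ⟨j, rfl⟩ := Fin.exists_succ_eq.2 (Fin.ne_zero_of_lt hij)
    rcases Fin.eq_zero_or_eq_succ i with rfl | ⟨i, rfl⟩
    · have h6 : (y j : ℕ) ≠ s := fun h => hs j hadj (Fin.ext h)
      rw [vs, e0, Fin.val_succ] at h
      split_ifs at h <;> omega
    · have h4 := h3 i j (Fin.succ_lt_succ_iff.1 hij) hadj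
      rw [vs, vs] at h
      split_ifs at h <;> omega

theorem linearShi_eq_image {n q : ℕ} {G : SimpleGraph (Fin (n + 2))}
    (hG : ∀ i j k : Fin (n + 2), i < j → j < k → G.Adj j k → G.Adj i k) :
    linearShi (q + 1) G = insertZero '' {p : (Fin (n + 1) → Fin (q + 1)) × Fin (q + 1) |
      p.1 ∈ linearShi q (G.comap Fin.succ) ∧ ∀ j, G.Adj 0 j.succ → p.1 j ≠ p.2} := by
  ext x
  constructor
  · intro hx
    -- The first place belongs to the last vertex, so the vertex `0` has a place `s` before it.
    have h0 : x 0 ≠ 0 := by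
      rw [← hx.2.1]
      exact fun h => (Fin.last_pos (n := n)).ne (hx.1 h)
    obtain ⟨s, hs⟩ := Fin.exists_succ_eq.2 h0
    have : ∀ j : Fin (n + 1), ∃ a, s.succ.succAbove a = x j.succ := fun j =>
      Fin.exists_succAbove_eq (by rw [hs]; exact fun h => Fin.succ_ne_zero j (hx.1 h))
    choose y hy using this
    have hxy : insertZero (y, s) = x := by
      ext1 i
      rcases Fin.eq_zero_or_eq_succ i with rfl | ⟨i, rfl⟩
      · exact hs
      · exact hy i
    exact ⟨(y, s), (insertZero_mem_linearShi hG y s).1 (hxy ▸ hx), hxy⟩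
  · rintro ⟨⟨y, s⟩, h, rfl⟩
    exact (insertZero_mem_linearShi hG y s).2 h

theorem card_forall_ne {α β : Type*} [Fintype β] [DecidableEq β] (A : Finset α) (y : α → β)
    (hy : Set.InjOn y A) :
    ({s : β | ∀ j ∈ A, y j ≠ s}.ncard : ℤ) = Fintype.card β - A.card := by
  have : {s : β | ∀ j ∈ A, y j ≠ s} = ((A.image y)ᶜ : Finset β) := by
    ext s
    simp
  rw [this, Set.ncard_coe_finset, Finset.card_compl, Nat.cast_sub (Finset.card_le_univ _),
    Finset.card_image_of_injOn hy]

theorem ncard_fiberwise {α β : Type*} [Finite α] [Finite β] (A : Set α) (P : α → β → Prop) (c : ℤ)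
    (h : ∀ a ∈ A, ({b | P a b}.ncard : ℤ) = c) :
    ({p : α × β | p.1 ∈ A ∧ P p.1 p.2}.ncard : ℤ) = A.ncard * c := by
  classical
  have := Fintype.ofFinite α
  have := Fintype.ofFinite β
  have e : {p : α × β | p.1 ∈ A ∧ P p.1 p.2} = (Finset.univ.filter
      fun p : α × β => p.1 ∈ A ∧ P p.1 p.2 : Finset (α × β)) := by ext; simp
  have e2 : A = (Finset.univ.filter fun a => a ∈ A : Finset α) := by ext; simp
  rw [e, Set.ncard_coe_finset, Finset.card_filter, Fintype.sum_prod_type]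
  conv_rhs => rw [e2, Set.ncard_coe_finset, Finset.card_filter]
  push_cast
  rw [Finset.sum_mul]
  refine Finset.sum_congr rfl fun a _ => ?_
  by_cases ha : a ∈ A
  · rw [if_pos ha, one_mul, ← h a ha]
    have : {b | P a b} = (Finset.univ.filter fun b => P a b : Finset β) := by ext; simp
    rw [this, Set.ncard_coe_finset, Finset.card_filter]
    simp [ha]
  · simp [ha]

theorem outdegree_comap_succ {n : ℕ} (G : SimpleGraph (Fin (n + 1))) (i : Fin n) :
    outdegree (G.comap Fin.succ) i = outdegree G i.succ := by
  classical
  unfold outdegree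
  rw [← Finset.card_map (Fin.succEmb n)]
  congr 1
  ext k
  simp only [Finset.mem_map, Finset.mem_filter, Finset.mem_univ, true_and, Fin.coe_succEmb,
    SimpleGraph.comap_adj]
  constructor
  · rintro ⟨j, ⟨h1, h2⟩, rfl⟩
    exact ⟨Fin.succ_lt_succ_iff.2 h1, h2⟩
  · rintro ⟨h1, h2⟩
    obtain ⟨j, rfl⟩ := Fin.exists_succ_eq.2 (Fin.ne_zero_of_lt h1)
    exact ⟨j, ⟨Fin.succ_lt_succ_iff.1 h1, h2⟩, rfl⟩

open Classical in
theorem card_filter_adj_zero {n : ℕ} (G : SimpleGraph (Fin (n + 1))) :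
    (Finset.univ.filter fun j : Fin n => G.Adj 0 j.succ).card = outdegree G 0 := by
  unfold outdegree
  rw [← Finset.card_map (Fin.succEmb n)]
  congr 1
  ext k
  simp only [Finset.mem_map, Finset.mem_filter, Finset.mem_univ, true_and, Fin.coe_succEmb]
  constructor
  · rintro ⟨j, h2, rfl⟩
    exact ⟨Fin.succ_pos _, h2⟩
  · rintro ⟨h1, h2⟩
    obtain ⟨j, rfl⟩ := Fin.exists_succ_eq.2 (Fin.ne_zero_of_lt h1)
    exact ⟨j, h2, rfl⟩

/-- The vertex `0` goes back after any of the places not held by one of its `outdegree G 0`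
neighbours, whatever the placement of the others. The line is one place shorter for the remaining
vertices, which accounts for the term `i`. -/
theorem ncard_linearShi (n : ℕ) : ∀ (q : ℕ) (G : SimpleGraph (Fin (n + 1))), n ≤ q →
    (∀ i j k : Fin (n + 1), i < j → j < k → G.Adj j k → G.Adj i k) →
    ((linearShi q G).ncard : ℤ) =
      ∏ i : Fin n, ((q : ℤ) - outdegree G i.castSucc - (i : ℕ)) := by
  classical
  induction n with
  | zero =>
    intro q G _ _
    have : Subsingleton (Fin (0 + 1)) := inferInstanceAs (Subsingleton (Fin 1))
    have : linearShi q G = {fun _ => 0} := by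
      ext x
      simp only [linearShi, Set.mem_ofPred_eq, Set.mem_singleton_iff]
      constructor
      · rintro ⟨-, h, -⟩
        ext1 i
        rw [Subsingleton.elim i (Fin.last 0), h]
      · rintro rfl
        refine ⟨Function.injective_of_subsingleton _, rfl, fun i j hij => ?_⟩
        exact absurd hij (by rw [Subsingleton.elim i j]; exact lt_irrefl _)
    simp [this]
  | succ n ih =>
    intro q G hq hG
    obtain ⟨q, rfl⟩ : ∃ r, q = r + 1 := ⟨q - 1, by omega⟩
    rw [linearShi_eq_image hG, Set.ncard_image_of_injective _ insertZero_injective,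
      ncard_fiberwise (linearShi q (G.comap Fin.succ)) (fun y s => ∀ j, G.Adj 0 j.succ → y j ≠ s)
        ((q + 1 : ℕ) - outdegree G 0), ih q _ (by omega), Fin.prod_univ_succ, mul_comm]
    · congr 1
      · simp
      · refine Finset.prod_congr rfl fun i _ => ?_
        rw [outdegree_comap_succ, ← Fin.succ_castSucc]
        push_cast
        simp only [Fin.val_succ]
        push_cast
        ring
    · intro i j k hij hjk h
      exact hG _ _ _ (Fin.succ_lt_succ_iff.2 hij) (Fin.succ_lt_succ_iff.2 hjk) h
    · intro y hy
      have := card_forall_ne (Finset.univ.filter fun j : Fin (n + 1) => G.Adj 0 j.succ) y hy.1.injOn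
      rw [card_filter_adj_zero] at this
      simpa using this

/-- The points of `(ℤ/q)ⁿ` that avoid the deleted Shi arrangement. -/
def shiPoints {n : ℕ} (q : ℕ) (G : SimpleGraph (Fin n)) : Set (Fin n → ZMod q) :=
  {x | Function.Injective x ∧ ∀ i j, i < j → G.Adj i j → x i - x j ≠ 1}

theorem ncard_shiPoints {n q : ℕ} {G : SimpleGraph (Fin (n + 1))} (hq : n < q)
    (hG : ∀ i j k : Fin (n + 1), i < j → j < k → G.Adj j k → G.Adj i k) :
    ((shiPoints q G).ncard : ℤ) =
      q * ∏ i : Fin n, ((q : ℤ) - outdegree G i.castSucc - ((i : ℕ) + 1)) := by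
  obtain ⟨q, rfl⟩ : ∃ r, q = r + 1 := ⟨q - 1, by omega⟩
  rw [ncard_eq_mul_of_translation _ (Fin.last n)]
  · have : {x ∈ shiPoints (q + 1) G | x (Fin.last n) = 0} = linearShi q G := by
      ext x
      change (Function.Injective x ∧ _) ∧ _ ↔ Function.Injective x ∧ _ ∧ _
      rw [and_assoc, and_comm (b := x (Fin.last n) = 0)]
      refine and_congr_right fun hinj => and_congr_right fun hlast => ?_
      refine forall₄_congr fun i j hij _ => not_congr ?_
      change Fin (n + 1) → Fin (q + 1) at x
      change x i - x j = (1 : Fin (q + 1)) ↔ _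
      rw [sub_eq_iff_eq_add', Fin.ext_iff, Fin.val_add_one]
      -- The circle wraps around only when `j` is on the last place and `i` on place `0`. Then `i`
      -- is the last vertex, contrary to `i < j`.
      split_ifs with h
      · have h1 : (x i : ℕ) ≠ 0 := fun h0 => by
          have : i = Fin.last n := hinj ((Fin.ext h0).trans hlast.symm)
          rw [this] at hij
          exact absurd hij (Fin.le_last j).not_gt
        have := (x i).is_lt
        rw [h, Fin.val_last]
        omega
      · rfl
    have hcard : {x ∈ shiPoints (q + 1) G | x (Fin.last n) = 0}.ncard = (linearShi q G).ncard :=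
      congrArg Set.ncard this
    rw [hcard, Nat.cast_mul, ncard_linearShi n q G (by omega) hG]
    congr 1
    push_cast
    refine Finset.prod_congr rfl fun i _ => ?_
    ring
  · rintro x ⟨h1, h2⟩ c
    exact ⟨fun i j hij => h1 (add_right_cancel hij), fun i j hij hadj => by
      simpa using h2 i j hij hadj⟩

/-- Negating coordinates and reversing labels turns `x i - x j` into a difference of the same form.
This exchanges the hypotheses of (a) and (b), and outdegrees with indegrees. -/
theorem ncard_shiPoints_comap_rev {n q : ℕ} [NeZero q] (G : SimpleGraph (Fin n)) :
    (shiPoints q (G.comap Fin.rev)).ncard = (shiPoints q G).ncard := by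
  have hinj : Function.Injective fun (x : Fin n → ZMod q) i => -x (Fin.rev i) := by
    intro x y h
    ext i
    simpa using congrFun h (Fin.rev i)
  rw [← Set.ncard_image_of_injective _ hinj]
  congr 1
  have key : ∀ (G : SimpleGraph (Fin n)) x, x ∈ shiPoints q (G.comap Fin.rev) →
      (fun i => -x (Fin.rev i)) ∈ shiPoints q G := by
    rintro G x ⟨h1, h2⟩
    refine ⟨fun i j hij => Fin.rev_injective (h1 (neg_injective hij)), fun i j hij hadj => ?_⟩
    rw [neg_sub_neg]
    exact h2 _ _ (Fin.rev_lt_rev.2 hij) (by simpa using hadj.symm)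
  ext x
  constructor
  · rintro ⟨x, hx, rfl⟩
    exact key G x hx
  · intro hx
    refine ⟨fun i => -x (Fin.rev i), key (G.comap Fin.rev) x ?_, by simp⟩
    convert hx
    ext i j
    simp

theorem outdegree_comap_rev {n : ℕ} (G : SimpleGraph (Fin n)) (i : Fin n) :
    outdegree (G.comap Fin.rev) i = indegree G i.rev := by
  classical
  unfold outdegree indegree
  rw [← Finset.card_map Fin.revPerm.toEmbedding]
  congr 1
  ext k
  simp only [Finset.mem_map, Finset.mem_filter, Finset.mem_univ, true_and, SimpleGraph.comap_adj]
  constructor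
  · rintro ⟨j, ⟨h1, h2⟩, rfl⟩
    exact ⟨Fin.rev_lt_rev.2 h1, h2.symm⟩
  · rintro ⟨h1, h2⟩
    exact ⟨k.rev, ⟨Fin.lt_rev_iff.1 h1, by simpa using h2.symm⟩, by simp⟩

theorem ncard_shiPoints' {n q : ℕ} {G : SimpleGraph (Fin (n + 1))} (hq : n < q)
    (hG : ∀ i j k : Fin (n + 1), i < j → j < k → G.Adj i j → G.Adj i k) :
    ((shiPoints q G).ncard : ℤ) =
      q * ∏ j : Fin n, ((q : ℤ) - indegree G j.succ - ((n : ℤ) - (j : ℕ))) := by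
  have : NeZero q := ⟨by omega⟩
  rw [← ncard_shiPoints_comap_rev, ncard_shiPoints hq]
  · congr 1
    rw [← Equiv.prod_comp Fin.revPerm]
    refine Finset.prod_congr rfl fun i _ => ?_
    rw [outdegree_comap_rev, Fin.revPerm_apply, ← Fin.rev_succ, Fin.rev_rev, Fin.val_rev]
    have := i.is_lt
    rw [Nat.cast_sub (by omega)]
    push_cast
    ring
  · intro i j k hij hjk h
    exact (hG _ _ _ (Fin.rev_lt_rev.2 hjk) (Fin.rev_lt_rev.2 hij) h.symm).symm

end Shi

end ShiIsh

namespace ShiIsh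

/-! ### Injections into nested sets, and rook placements -/

section Injections

/-- The injections with `f i ∈ A i` for all `i`. -/
def injectionsInto {α β : Type*} (A : α → Finset β) : Set (α → β) :=
  {f | Function.Injective f ∧ ∀ i, f i ∈ A i}

/-- Values are chosen from the smallest set upwards, hence from the last index down. The values
already chosen lie in the current set, so their number is subtracted from its size. -/
theorem ncard_injectionsInto_of_antitone {β : Type*} [Finite β] (m : ℕ) :
    ∀ A : Fin m → Finset β, Antitone A → ((injectionsInto A).ncard : ℤ) =
      ∏ i : Fin m, (((A i).card : ℤ) - ((m : ℤ) - 1 - (i : ℕ))) := by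
  classical
  have := Fintype.ofFinite β
  induction m with
  | zero =>
    intro A _
    have : injectionsInto A = {Fin.elim0} := by
      ext f
      simp only [injectionsInto, Set.mem_ofPred_eq, Set.mem_singleton_iff]
      exact ⟨fun _ => Subsingleton.elim _ _, fun _ => ⟨Function.injective_of_subsingleton _,
        fun i => i.elim0⟩⟩
    simp [this]
  | succ m ih =>
    intro A hA
    have himage : injectionsInto A = (fun p : (Fin m → β) × β => (Fin.cons p.2 p.1 : Fin (m + 1) → β)) ''
        {p | p.1 ∈ injectionsInto (fun i : Fin m => A i.succ) ∧ (p.2 ∈ A 0 ∧ p.2 ∉ Set.range p.1)} := by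
      ext f
      constructor
      · rintro ⟨h1, h2⟩
        refine ⟨(Fin.tail f, f 0), ⟨⟨fun i j hij => Fin.succ_injective _ (h1 hij),
          fun i => h2 i.succ⟩, h2 0, ?_⟩, Fin.cons_self_tail f⟩
        rintro ⟨i, hi⟩
        exact Fin.succ_ne_zero i (h1 hi)
      · rintro ⟨⟨g, b⟩, ⟨⟨h1, h2⟩, h3, h4⟩, rfl⟩
        refine ⟨Fin.cons_injective_iff.2 ⟨h4, h1⟩, fun i => ?_⟩
        rcases Fin.eq_zero_or_eq_succ i with rfl | ⟨i, rfl⟩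
        · exact h3
        · exact h2 i
    have hinj : Function.Injective
        fun p : (Fin m → β) × β => (Fin.cons p.2 p.1 : Fin (m + 1) → β) := by
      rintro ⟨g, b⟩ ⟨g', b'⟩ h
      obtain ⟨h1, h2⟩ := Fin.cons_inj.1 h
      exact Prod.ext h2 h1
    rw [himage, Set.ncard_image_of_injective _ hinj,
      ncard_fiberwise (injectionsInto fun i : Fin m => A i.succ) (fun g b => b ∈ A 0 ∧ b ∉ Set.range g)
        ((A 0).card - m),
      ih _ (fun i j hij => hA (Fin.succ_le_succ_iff.2 hij)), Fin.prod_univ_succ, mul_comm]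
    · congr 1
      · simp
      · refine Finset.prod_congr rfl fun i _ => ?_
        rw [Fin.val_succ]
        push_cast
        ring
    · rintro g ⟨h1, h2⟩
      have hsub : Finset.univ.image g ⊆ A 0 := by
        intro b hb
        obtain ⟨i, -, rfl⟩ := Finset.mem_image.1 hb
        exact hA (Fin.zero_le _) (h2 i)
      have : {b | b ∈ A 0 ∧ b ∉ Set.range g} = ((A 0 \ Finset.univ.image g : Finset β) : Set β) := by
        ext b
        simp
      rw [this, Set.ncard_coe_finset, Finset.cast_card_sdiff hsub,
        Finset.card_image_of_injective _ h1]
      simp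

theorem ncard_injectionsInto_of_monotone {β : Type*} [Finite β] {m : ℕ}
    (A : Fin m → Finset β) (hA : Monotone A) : ((injectionsInto A).ncard : ℤ) =
      ∏ i : Fin m, (((A i).card : ℤ) - (i : ℕ)) := by
  have hinj : Function.Injective fun (f : Fin m → β) i => f (Fin.rev i) := by
    intro f g h
    ext1 i
    simpa using congrFun h (Fin.rev i)
  have h : injectionsInto A =
      (fun f i => f (Fin.rev i)) '' injectionsInto fun i => A (Fin.rev i) := by
    ext f
    constructor
    · rintro ⟨h1, h2⟩
      exact ⟨fun i => f (Fin.rev i), ⟨h1.comp Fin.rev_injective, fun i => h2 _⟩, by simp⟩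
    · rintro ⟨f, ⟨h1, h2⟩, rfl⟩
      exact ⟨h1.comp Fin.rev_injective, fun i => by simpa using h2 (Fin.rev i)⟩
  rw [h, Set.ncard_image_of_injective _ hinj, ncard_injectionsInto_of_antitone m _
    (fun i j hij => hA (Fin.rev_le_rev.2 hij)), ← Equiv.prod_comp Fin.revPerm]
  refine Finset.prod_congr rfl fun i _ => ?_
  have := i.is_lt
  rw [Fin.revPerm_apply, Fin.rev_rev, Fin.val_rev, Nat.cast_sub (by omega)]
  push_cast
  ring

open Classical in
/-- The places in `α ⊕ γ` that are allowed for the rook in column `j`, if the cells `(i, j)` with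
`R i j` are forbidden. -/
noncomputable def allowed {α γ : Type*} [Fintype α] [Fintype γ] (R : α → α → Prop) (j : α) :
    Finset (α ⊕ γ) :=
  Finset.univ.filter fun a => ∀ i, R i j → a ≠ Sum.inl i

theorem mem_allowed {α γ : Type*} [Fintype α] [Fintype γ] {R : α → α → Prop} {j : α}
    {a : α ⊕ γ} : a ∈ allowed R j ↔ ∀ i, R i j → a ≠ Sum.inl i := by
  simp [allowed]

/-- The permutations extending `y` form a coset `e₀ * H`, where `H` is the pointwise stabilizer of
the left summand, so their number does not depend on `y`. -/
theorem ncard_perm_comp_inl {α γ : Type*} [Fintype α] [Fintype γ] (y : α → α ⊕ γ)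
    (hy : Function.Injective y) :
    {e : Equiv.Perm (α ⊕ γ) | ∀ j, e (Sum.inl j) = y j}.ncard =
      {e : Equiv.Perm (α ⊕ γ) | ∀ j, e (Sum.inl j) = Sum.inl j}.ncard := by
  classical
  let e₀ : Equiv.Perm (α ⊕ γ) := Equiv.extendSubtype (p := fun a => a ∈ Set.range Sum.inl)
    (q := fun a => a ∈ Set.range y)
    ((Equiv.ofInjective Sum.inl Sum.inl_injective).symm.trans (Equiv.ofInjective y hy))
  have he₀ : ∀ j, e₀ (Sum.inl j) = y j := by
    intro j
    have h := Equiv.extendSubtype_apply_of_mem (p := fun a => a ∈ Set.range Sum.inl)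
      (q := fun a => a ∈ Set.range y)
      ((Equiv.ofInjective Sum.inl Sum.inl_injective).symm.trans (Equiv.ofInjective y hy))
      (Sum.inl j : α ⊕ γ) ⟨j, rfl⟩
    refine h.trans ?_
    have : (Equiv.ofInjective (Sum.inl : α → α ⊕ γ) Sum.inl_injective).symm ⟨Sum.inl j, ⟨j, rfl⟩⟩ =
        j := by
      rw [Equiv.symm_apply_eq]
      rfl
    simp [this]
  have h : {e : Equiv.Perm (α ⊕ γ) | ∀ j, e (Sum.inl j) = y j} =
      (fun e => e₀ * e) '' {e : Equiv.Perm (α ⊕ γ) | ∀ j, e (Sum.inl j) = Sum.inl j} := by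
    ext e
    constructor
    · intro h
      refine ⟨e₀⁻¹ * e, fun j => ?_, by simp⟩
      rw [Equiv.Perm.mul_apply, h j, Equiv.Perm.inv_eq_iff_eq, he₀]
    · rintro ⟨e, h, rfl⟩ j
      rw [Equiv.Perm.mul_apply, h j, he₀]
  rw [h, Set.ncard_image_of_injective _ (mul_right_injective e₀)]

/-- Completing rook placements to permutations makes transposition available as inversion, at the
cost of a factor independent of `R`. -/
theorem ncard_perm_eq_mul {α γ : Type*} [Fintype α] [Fintype γ] (R : α → α → Prop) :
    ({e : Equiv.Perm (α ⊕ γ) | ∀ i j, R i j → e (Sum.inl j) ≠ Sum.inl i}.ncard : ℤ) =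
      (injectionsInto (allowed (γ := γ) R)).ncard *
        {e : Equiv.Perm (α ⊕ γ) | ∀ j, e (Sum.inl j) = Sum.inl j}.ncard := by
  classical
  rw [← ncard_fiberwise (injectionsInto (allowed (γ := γ) R))
    (fun y (e : Equiv.Perm (α ⊕ γ)) => ∀ j, e (Sum.inl j) = y j) _
    (fun y hy => by rw [ncard_perm_comp_inl y hy.1])]
  congr 1
  rw [← Set.ncard_image_of_injective (f := fun e : Equiv.Perm (α ⊕ γ) => (fun j => e (Sum.inl j), e))]
  · congr 1
    ext ⟨y, e⟩
    constructor
    · rintro ⟨e, he, h⟩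
      obtain ⟨rfl, rfl⟩ := Prod.ext_iff.1 h
      exact ⟨⟨e.injective.comp Sum.inl_injective, fun j =>
        mem_allowed.2 fun i => he i j⟩, fun _ => rfl⟩
    · rintro ⟨⟨h1, h2⟩, h3⟩
      obtain rfl : (fun j => e (Sum.inl j)) = y := funext h3
      exact ⟨e, fun i j hij => mem_allowed.1 (h2 j) i hij, rfl⟩
  · intro e e' h
    exact (Prod.ext_iff.1 h).2

/-- Rook placements on a board and on its transpose are equinumerous. -/
theorem ncard_injectionsInto_allowed_swap {α γ : Type*} [Fintype α] [Fintype γ]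
    (R : α → α → Prop) : (injectionsInto (allowed (γ := γ) R)).ncard =
      (injectionsInto (allowed (γ := γ) (Function.swap R))).ncard := by
  classical
  -- The common factor counts a set containing the identity, so it can be cancelled.
  have hc : ({e : Equiv.Perm (α ⊕ γ) | ∀ j, e (Sum.inl j) = Sum.inl j}.ncard : ℤ) ≠ 0 := by
    rw [Nat.cast_ne_zero, ← Nat.pos_iff_ne_zero, Set.ncard_pos]
    exact ⟨1, fun j => rfl⟩
  have h1 := ncard_perm_eq_mul (γ := γ) R
  have h2 := ncard_perm_eq_mul (γ := γ) (Function.swap R)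
  have h3 : {e : Equiv.Perm (α ⊕ γ) | ∀ i j, Function.swap R i j → e (Sum.inl j) ≠ Sum.inl i} =
      (fun e => e⁻¹) ''
        {e : Equiv.Perm (α ⊕ γ) | ∀ i j, R i j → e (Sum.inl j) ≠ Sum.inl i} := by
    ext e
    constructor
    · intro h
      refine ⟨e⁻¹, fun i j hij h' => h j i hij ?_, inv_inv e⟩
      rw [← h', ← Equiv.Perm.mul_apply, mul_inv_cancel, Equiv.Perm.one_apply]
    · rintro ⟨e, h, rfl⟩ i j hij h'
      refine h j i hij ?_
      rw [← h', ← Equiv.Perm.mul_apply, mul_inv_cancel, Equiv.Perm.one_apply]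
  rw [h3, Set.ncard_image_of_injective _ inv_injective, h1] at h2
  exact_mod_cast mul_right_cancel₀ hc h2

theorem card_allowed {α γ : Type*} [Fintype α] [Fintype γ] (R : α → α → Prop) (j : α)
    [DecidablePred fun i => R i j] :
    ((allowed (γ := γ) R j).card : ℤ) =
      Fintype.card α + Fintype.card γ - (Finset.univ.filter fun i => R i j).card := by
  classical
  have : allowed (γ := γ) R j = ((Finset.univ.filter fun i => R i j).map Function.Embedding.inl)ᶜ := by
    ext a
    simp only [mem_allowed, Finset.mem_filter, Finset.mem_univ, true_and, Finset.mem_compl,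
      Finset.mem_map, not_exists, not_and, Function.Embedding.inl_apply]
    exact forall₂_congr fun i _ => ne_comm
  rw [this, Finset.card_compl, Nat.cast_sub (Finset.card_le_univ _), Finset.card_map,
    Fintype.card_sum]
  push_cast
  rfl

end Injections

/-! ### Points off the deleted Ish arrangement -/

section Ish

/-- The points of `(ℤ/q)ⁿ` that avoid the deleted Ish arrangement. -/
def ishPoints {n : ℕ} (q : ℕ) (G : SimpleGraph (Fin (n + 1))) : Set (Fin (n + 1) → ZMod q) :=
  {x | Function.Injective x ∧ ∀ i j, i < j → G.Adj i j → x 0 - x j ≠ ((i : ℕ) + 1 : ℕ)}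

/-- The nonzero elements of `ℤ/(m + r + 1)`, the first `m` of them being `1, …, m`. -/
def nonzeroElement (m r : ℕ) (a : Fin m ⊕ Fin r) : ZMod (m + r + 1) :=
  (((finSumFinEquiv a : Fin (m + r)) : ℕ) + 1 : ℕ)

theorem nonzeroElement_injective (m r : ℕ) : Function.Injective (nonzeroElement m r) := by
  intro a b h
  rw [nonzeroElement, nonzeroElement, ZMod.natCast_eq_natCast_iff', Nat.mod_eq_of_lt (by omega),
    Nat.mod_eq_of_lt (by omega)] at h
  exact finSumFinEquiv.injective (Fin.ext (by omega))

theorem nonzeroElement_ne_zero (m r : ℕ) (a : Fin m ⊕ Fin r) : nonzeroElement m r a ≠ 0 := by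
  intro h
  rw [nonzeroElement, ZMod.natCast_eq_zero_iff] at h
  have := Nat.le_of_dvd (by omega) h
  omega

theorem exists_nonzeroElement {m r : ℕ} {z : ZMod (m + r + 1)} (hz : z ≠ 0) :
    ∃ a, nonzeroElement m r a = z := by
  have h1 : z.val ≠ 0 := by rwa [Ne, ZMod.val_eq_zero]
  have h2 := z.val_lt
  refine ⟨finSumFinEquiv.symm ⟨z.val - 1, by omega⟩, ?_⟩
  rw [nonzeroElement, Equiv.apply_symm_apply]
  simp only
  rw [Nat.sub_add_cancel (by omega), ZMod.natCast_zmod_val]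

/-- The edges of `G`, as a board with rows `1, …, m` and columns `2, …, m + 1`. -/
def edgeBoard {m : ℕ} (G : SimpleGraph (Fin (m + 1))) (i j : Fin m) : Prop :=
  i.castSucc < j.succ ∧ G.Adj i.castSucc j.succ

/-- With `x 0 = 0`, the values `-x j` are distinct nonzero residues and `-x j` must avoid the label
of every smaller neighbour of `j`. The modulus exceeds `m`, so these labels are distinct and
nonzero; the other `r` residues are unrestricted rows. -/
theorem ncard_ishPoints_eq_mul {m r : ℕ} (G : SimpleGraph (Fin (m + 1))) :
    (ishPoints (m + r + 1) G).ncard =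
      (m + r + 1) * (injectionsInto (allowed (γ := Fin r) (edgeBoard G))).ncard := by
  rw [ncard_eq_mul_of_translation _ 0]
  · congr 1
    have hinj : Function.Injective fun (y : Fin m → Fin m ⊕ Fin r) =>
        (Fin.cons 0 (fun j => -nonzeroElement m r (y j)) : Fin (m + 1) → ZMod (m + r + 1)) := by
      intro y y' h
      ext1 j
      exact nonzeroElement_injective m r (neg_injective (congrFun (Fin.cons_inj.1 h).2 j))
    rw [← Set.ncard_image_of_injective _ hinj]
    congr 1
    ext x
    constructor
    · rintro ⟨⟨h1, h2⟩, h0⟩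
      have : ∀ j : Fin m, ∃ a, nonzeroElement m r a = -x j.succ := fun j =>
        exists_nonzeroElement (neg_ne_zero.2 fun h => Fin.succ_ne_zero j (h1 (h.trans h0.symm)))
      choose y hy using this
      refine ⟨y, ⟨fun i j hij => ?_, fun j => ?_⟩, ?_⟩
      · have : x i.succ = x j.succ := neg_injective (by rw [← hy, ← hy, hij])
        exact Fin.succ_injective _ (h1 this)
      · refine mem_allowed.2 ?_
        rintro i ⟨hij, hadj⟩ h
        refine h2 _ _ hij hadj ?_
        rw [h0, zero_sub, ← hy, h]
        simp [nonzeroElement]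
      · ext1 j
        rcases Fin.eq_zero_or_eq_succ j with rfl | ⟨j, rfl⟩
        · exact h0.symm
        · simp [hy]
    · rintro ⟨y, ⟨h1, h2⟩, rfl⟩
      refine ⟨⟨Fin.cons_injective_iff.2 ⟨?_, ?_⟩, ?_⟩, rfl⟩
      · rintro ⟨j, hj⟩
        exact nonzeroElement_ne_zero m r _ (neg_eq_zero.1 hj)
      · exact fun i j hij => h1 (nonzeroElement_injective m r (neg_injective hij))
      · intro i j hij hadj h
        obtain ⟨j, rfl⟩ := Fin.exists_succ_eq.2 (Fin.ne_zero_of_lt hij)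
        obtain ⟨i, rfl⟩ := Fin.exists_castSucc_eq.2 (Fin.ne_last_of_lt hij)
        have h3 := mem_allowed.1 (h2 j) i ⟨hij, hadj⟩
        refine h3 (nonzeroElement_injective m r ?_)
        simp only [Fin.cons_zero, Fin.cons_succ, zero_sub, neg_neg] at h
        rw [h]
        simp [nonzeroElement]
  · rintro x ⟨h1, h2⟩ c
    exact ⟨fun i j hij => h1 (add_right_cancel hij), fun i j hij hadj => by
      simpa using h2 i j hij hadj⟩

open Classical in
theorem card_edgeBoard_row {m : ℕ} (G : SimpleGraph (Fin (m + 1))) (i : Fin m) :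
    (Finset.univ.filter fun j => edgeBoard G i j).card = outdegree G i.castSucc := by
  unfold outdegree
  rw [← Finset.card_map (Fin.succEmb m)]
  congr 1
  ext k
  simp only [Finset.mem_map, Finset.mem_filter, Finset.mem_univ, true_and, Fin.coe_succEmb]
  constructor
  · rintro ⟨j, h, rfl⟩
    exact h
  · rintro h
    obtain ⟨j, rfl⟩ := Fin.exists_succ_eq.2 (Fin.ne_zero_of_lt h.1)
    exact ⟨j, h, rfl⟩

open Classical in
theorem card_edgeBoard_column {m : ℕ} (G : SimpleGraph (Fin (m + 1))) (j : Fin m) :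
    (Finset.univ.filter fun i => edgeBoard G i j).card = indegree G j.succ := by
  unfold indegree
  rw [← Finset.card_map Fin.castSuccEmb]
  congr 1
  ext k
  simp only [Finset.mem_map, Finset.mem_filter, Finset.mem_univ, true_and, Fin.coe_castSuccEmb]
  constructor
  · rintro ⟨j, h, rfl⟩
    exact h
  · rintro h
    obtain ⟨i, rfl⟩ := Fin.exists_castSucc_eq.2 (Fin.ne_last_of_lt h.1)
    exact ⟨i, h, rfl⟩

theorem ncard_ishPoints {n q : ℕ} {G : SimpleGraph (Fin (n + 1))} (hq : n < q)
    (hG : ∀ i j k : Fin (n + 1), i < j → j < k → G.Adj j k → G.Adj i k) :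
    ((ishPoints q G).ncard : ℤ) =
      q * ∏ i : Fin n, ((q : ℤ) - outdegree G i.castSucc - ((i : ℕ) + 1)) := by
  classical
  obtain ⟨r, rfl⟩ : ∃ r, q = n + r + 1 := ⟨q - n - 1, by omega⟩
  -- After transposition, the forbidden set of `i` consists of its larger neighbours; by `hG` it
  -- shrinks as `i` grows.
  have hmono : Monotone (allowed (γ := Fin r) (Function.swap (edgeBoard G))) := by
    intro i i' hii' a ha
    rw [mem_allowed] at ha ⊢
    rintro j ⟨h1, h2⟩
    rcases hii'.eq_or_lt with rfl | hlt
    · exact ha j ⟨h1, h2⟩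
    · have hlt' : i.castSucc < i'.castSucc := hlt
      exact ha j ⟨hlt'.trans h1, hG _ _ _ hlt' h1 h2⟩
  rw [ncard_ishPoints_eq_mul, ncard_injectionsInto_allowed_swap, Nat.cast_mul,
    ncard_injectionsInto_of_monotone _ hmono]
  congr 1
  refine Finset.prod_congr rfl fun i _ => ?_
  -- The board has `n + r = q - 1` places, whence the extra `1` in each factor.
  rw [card_allowed, ← card_edgeBoard_row]
  simp only [Function.swap, Fintype.card_fin]
  push_cast
  ring

theorem ncard_ishPoints' {n q : ℕ} {G : SimpleGraph (Fin (n + 1))} (hq : n < q)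
    (hG : ∀ i j k : Fin (n + 1), i < j → j < k → G.Adj i j → G.Adj i k) :
    ((ishPoints q G).ncard : ℤ) =
      q * ∏ j : Fin n, ((q : ℤ) - indegree G j.succ - ((n : ℤ) - (j : ℕ))) := by
  classical
  obtain ⟨r, rfl⟩ : ∃ r, q = n + r + 1 := ⟨q - n - 1, by omega⟩
  -- Here the forbidden set of a column consists of the smaller neighbours of its vertex; by `hG` it
  -- grows with the vertex, and no transposition is needed.
  have hanti : Antitone (allowed (γ := Fin r) (edgeBoard G)) := by
    intro j j' hjj' a ha
    rw [mem_allowed] at ha ⊢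
    rintro i ⟨h1, h2⟩
    rcases hjj'.eq_or_lt with rfl | hlt
    · exact ha i ⟨h1, h2⟩
    · have hlt' : j.succ < j'.succ := Fin.succ_lt_succ_iff.2 hlt
      exact ha i ⟨h1.trans hlt', hG _ _ _ h1 hlt' h2⟩
  rw [ncard_ishPoints_eq_mul, Nat.cast_mul, ncard_injectionsInto_of_antitone _ _ hanti]
  congr 1
  refine Finset.prod_congr rfl fun i _ => ?_
  rw [card_allowed, ← card_edgeBoard_column]
  simp only [Fintype.card_fin]
  push_cast
  ring

end Ish

end ShiIsh

namespace ShiIsh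

/-! ### The two arrangements as difference arrangements -/

section Final

variable {n : ℕ}

open Classical in
/-- The index set of the deleted Shi arrangement. -/
noncomputable def shiIndex (G : SimpleGraph (Fin n)) : Finset (Fin n × Fin n × ℤ) :=
  ((Finset.univ.filter fun e : Fin n × Fin n => e.1 < e.2).image fun e => (e.1, e.2, 0)) ∪
    (edges G).image fun e => (e.1, e.2, 1)

open Classical in
/-- The index set of the deleted Ish arrangement. -/
noncomputable def ishIndex (G : SimpleGraph (Fin (n + 1))) : Finset (Fin (n + 1) × Fin (n + 1) × ℤ) :=
  ((Finset.univ.filter fun e : Fin (n + 1) × Fin (n + 1) => e.1 < e.2).image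
    fun e => (e.1, e.2, 0)) ∪
    (edges G).image fun e => (0, e.2, ((e.1 : ℕ) : ℤ) + 1)

theorem mem_shi_iff (G : SimpleGraph (Fin n)) (Y : AffineSubspace ℝ (Fin n → ℝ)) :
    Y ∈ shi G ↔ ∃ t ∈ shiIndex G, diffHyperplane t.1 t.2.1 (t.2.2 : ℝ) = Y := by
  classical
  unfold shi cox shiIndex
  simp only [Finset.mem_union, Finset.mem_image, or_and_right, exists_or]
  simp

theorem mem_ish_iff (G : SimpleGraph (Fin (n + 1))) (Y : AffineSubspace ℝ (Fin (n + 1) → ℝ)) :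
    Y ∈ ish G ↔ ∃ t ∈ ishIndex G, diffHyperplane t.1 t.2.1 (t.2.2 : ℝ) = Y := by
  classical
  unfold ish cox ishIndex
  simp only [Finset.mem_union, Finset.mem_image, or_and_right, exists_or]
  simp

/-- This turns avoidance of the Coxeter hyperplanes into distinctness of the coordinates. -/
theorem injective_iff_forall_lt {α : Type*} [AddGroup α] (x : Fin n → α) :
    Function.Injective x ↔ ∀ i j, i < j → x i - x j ≠ 0 := by
  simp only [ne_eq, sub_eq_zero]
  constructor
  · intro h i j hij h'
    exact hij.ne (h h')
  · intro h i j hij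
    rcases lt_trichotomy i j with hlt | heq | hlt
    · exact absurd hij (h _ _ hlt)
    · exact heq
    · exact absurd hij.symm (h _ _ hlt)

theorem avoiding_shiIndex (q : ℕ) (G : SimpleGraph (Fin n)) :
    avoiding q (shiIndex G) = shiPoints q G := by
  classical
  ext x
  rw [shiPoints, Set.mem_ofPred_eq, injective_iff_forall_lt]
  simp only [avoiding, shiIndex, edges, Set.mem_ofPred_eq, Finset.mem_union, Finset.mem_image,
    Finset.mem_filter, Finset.mem_univ, true_and, or_imp, forall_and, Prod.exists,
    forall_exists_index, and_imp]
  constructor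
  · rintro ⟨h1, h2⟩
    exact ⟨fun i j hij => by simpa using h1 _ _ _ hij rfl,
      fun i j hij hadj => by simpa using h2 _ _ _ hij hadj rfl⟩
  · rintro ⟨h1, h2⟩
    constructor
    · rintro _ i j hij rfl
      simpa using h1 i j hij
    · rintro _ i j hij hadj rfl
      simpa using h2 i j hij hadj

theorem avoiding_ishIndex (q : ℕ) (G : SimpleGraph (Fin (n + 1))) :
    avoiding q (ishIndex G) = ishPoints q G := by
  classical
  ext x
  rw [ishPoints, Set.mem_ofPred_eq, injective_iff_forall_lt]
  simp only [avoiding, ishIndex, edges, Set.mem_ofPred_eq, Finset.mem_union, Finset.mem_image,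
    Finset.mem_filter, Finset.mem_univ, true_and, or_imp, forall_and, Prod.exists,
    forall_exists_index, and_imp]
  constructor
  · rintro ⟨h1, h2⟩
    exact ⟨fun i j hij => by simpa using h1 _ _ _ hij rfl,
      fun i j hij hadj => by simpa using h2 _ _ _ hij hadj rfl⟩
  · rintro ⟨h1, h2⟩
    constructor
    · rintro _ i j hij rfl
      simpa using h1 i j hij
    · rintro _ i j hij hadj rfl
      simpa using h2 i j hij hadj

theorem charPoly_shi_eq (G : SimpleGraph (Fin n)) (P : ℤ[X])
    (hP : ∀ q : ℕ, n ≤ q → 0 < q → ((shiPoints q G).ncard : ℤ) = P.eval (q : ℤ)) :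
    charPoly (shi G) = P := by
  classical
  refine charPoly_eq_of_ncard_avoiding (shiIndex G) ?_ P n
    (fun q hq hpos => by rw [avoiding_shiIndex, hP q hq hpos]) _ (mem_shi_iff G)
  intro t ht
  simp only [shiIndex, edges, Finset.mem_union, Finset.mem_image, Finset.mem_filter] at ht
  rcases ht with ⟨e, he, rfl⟩ | ⟨e, he, rfl⟩
  · exact he.2.ne
  · exact he.2.1.ne

theorem charPoly_ish_eq (G : SimpleGraph (Fin (n + 1))) (P : ℤ[X])
    (hP : ∀ q : ℕ, n + 1 ≤ q → 0 < q → ((ishPoints q G).ncard : ℤ) = P.eval (q : ℤ)) :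
    charPoly (ish G) = P := by
  classical
  refine charPoly_eq_of_ncard_avoiding (ishIndex G) ?_ P (n + 1)
    (fun q hq hpos => by rw [avoiding_ishIndex, hP q hq hpos]) _ (mem_ish_iff G)
  intro t ht
  simp only [ishIndex, edges, Finset.mem_union, Finset.mem_image, Finset.mem_filter] at ht
  rcases ht with ⟨e, he, rfl⟩ | ⟨e, he, rfl⟩
  · exact he.2.ne
  · exact (Fin.ne_zero_of_lt he.2.1).symm

theorem prod_filter_succ_lt {M : Type*} [CommMonoid M] (f : Fin (n + 1) → M) :
    ∏ i ∈ (Finset.univ : Finset (Fin (n + 1))).filter (fun i : Fin (n + 1) => (i : ℕ) + 1 < n + 1),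
      f i = ∏ i : Fin n, f i.castSucc := by
  rw [Finset.prod_filter, Fin.prod_univ_castSucc]
  simp

theorem prod_filter_pos {M : Type*} [CommMonoid M] (f : Fin (n + 1) → M) :
    ∏ i ∈ (Finset.univ : Finset (Fin (n + 1))).filter (fun i : Fin (n + 1) => 0 < (i : ℕ)),
      f i = ∏ i : Fin n, f i.succ := by
  rw [Finset.prod_filter, Fin.prod_univ_succ]
  simp

end Final

end ShiIsh

theorem mainTheorem5 (n : ℕ) [NeZero n] (G : SimpleGraph (Fin n)) :
    ((∀ i j k : Fin n, i < j → j < k → G.Adj j k → G.Adj i k) →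
      ShiIsh.charPoly (ShiIsh.shi G) = ShiIsh.charPoly (ShiIsh.ish G) ∧
      ShiIsh.charPoly (ShiIsh.ish G) =
        X * ∏ i ∈ (Finset.univ : Finset (Fin n)).filter (fun i : Fin n => (i : ℕ) + 1 < n),
          (X - C (ShiIsh.outdegree G i : ℤ) - C (((i : ℕ) : ℤ) + 1))) ∧
    ((∀ i j k : Fin n, i < j → j < k → G.Adj i j → G.Adj i k) →
      ShiIsh.charPoly (ShiIsh.shi G) = ShiIsh.charPoly (ShiIsh.ish G) ∧
      ShiIsh.charPoly (ShiIsh.ish G) =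
        X * ∏ j ∈ (Finset.univ : Finset (Fin n)).filter (fun j : Fin n => 0 < (j : ℕ)),
          (X - C (ShiIsh.indegree G j : ℤ) - C ((n : ℤ) - ((j : ℕ) : ℤ)))) := by

  obtain ⟨n, rfl⟩ := Nat.exists_eq_succ_of_ne_zero (NeZero.ne n)
  refine ⟨fun hG => ?_, fun hG => ?_⟩
  · rw [ShiIsh.prod_filter_succ_lt]
    refine (fun h => ⟨(ShiIsh.charPoly_shi_eq G _ ?_).trans h.symm, h⟩)
      (ShiIsh.charPoly_ish_eq G _ ?_)
    all_goals
      intro q hq _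
      first
        | rw [ShiIsh.ncard_shiPoints hq hG]
        | rw [ShiIsh.ncard_ishPoints hq hG]
      simp [Polynomial.eval_prod]
  · rw [ShiIsh.prod_filter_pos]
    refine (fun h => ⟨(ShiIsh.charPoly_shi_eq G _ ?_).trans h.symm, h⟩)
      (ShiIsh.charPoly_ish_eq G _ ?_)
    all_goals
      intro q hq _
      first
        | rw [ShiIsh.ncard_shiPoints' hq hG]
        | rw [ShiIsh.ncard_ishPoints' hq hG]
      simp [Polynomial.eval_prod]
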